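/- Let $G$ be a finite connected graph, possibly with multiple edges and loops, with vertex set $V(G)$ and $m$ unoriented edges. Let $D(G)$ be its set of $2m$ arcs: every edge (loops included) gives two mutually inverse arcs $e\neq e^{-1}$. Let $o(e)$ and $t(e)$ be the origin and terminus of an arc $e$, and let $d_v$ be the number of arcs with origin $v$. Let $L:D(G)\to\mathbb{R}_{>0}$ and $A:D(G)\to\mathbb{R}$ satisfy $L_{e^{-1}}=L_e$ and $A_{e^{-1}}=-A_e$. Let $\lambda:V(G)\to\mathbb{C}$ and let $k\in\mathbb{C}$ satisfy $\mathbf{i}kd_v\neq\lambda_v$ for all $v$. Put $$x_v=\frac{2\mathbf{i}k}{\mathbf{i}kd_v-\lambda_v},\qquad t_e=e^{\mathbf{i}L_e(k-A_e)},\qquad \sigma_{ef}=x_{o(e)}-\delta_{e^{-1}f}\quad (e,f\in D(G),\ t(f)=o(e)).$$ Let $\Gamma$ be a finite group, let $\alpha:D(G)\to\Gamma$ satisfy $\alpha(e^{-1})=\alpha(e)^{-1}$, and let $\rho:\Gamma\to GL_d(\mathbb{C})$ be a representation of degree $d$. For $h\in\Gamma$ let $\mathbf{U}_h$ be the $2m\times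 2m$ matrix, indexed by $D(G)$, whose $(e,f)$ entry is $t_e\sigma_{ef}$ if $t(f)=o(e)$ and $\alpha(f)=h$, and $0$ otherwise. Define $$\zeta_G(A,L,\lambda,\rho,\alpha,s)=\det\Bigl(\mathbf{I}_{2md}-s\sum_{h\in\Gamma}{}^t\rho(h)\otimes\mathbf{U}_h\Bigr)^{-1}.$$ A cycle of length $|C|=p\ge 1$ is a sequence of arcs $C=(e_1,\dots,e_p)$ with $t(e_i)=o(e_{i+1})$ for $1\le i<p$ and $t(e_p)=o(e_1)$; backtracking is allowed. Two cycles are equivalent if they are cyclic rotations of each other. A cycle is prime if it is not a power of a strictly shorter cycle. For a cycle $C$ put $\alpha(C)=\alpha(e_1)\cdots\alpha(e_p)$, $t_C=t_{e_1}\cdots t_{e_p}$ and $a_C=\sigma_{e_1e_p}\sigma_{e_pe_{p-1}}\cdots\sigma_{e_2e_1}$. Then there is $r>0$ such that for every $s\in\mathbb{C}$ with $|s|<r$ the determinant defining $\zeta_G$ and all the determinants below are nonzero, the product below converges unconditionally, and $$\zeta_G(A,L,\lambda,\rho,\alpha,s)=\prod_{[C]}\det\bigl(\mathbf{I}_d-{}^t\rho(\alpha(C))\,t_C\,a_C\,s^{|C|}\bigr)^{-1},$$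 where $[C]$ runs over all equivalence classes of prime cycles of $G$; each factor depends only on the class $[C]$. -/

import Mathlib

open scoped Kronecker

/-- A graph, possibly with multiple edges and loops, given by its vertices `V` and its arcs `D`
(oriented edges). Every unoriented edge, loops included, gives exactly two arcs `e` and `inv e`;
so `D` has twice as many elements as there are unoriented edges. -/
structure ArcGraph (V D : Type*) where
  /-- the origin `o(e)` of an arc -/
  o : D → V
  /-- the terminus `t(e)` of an arc -/
  t : D → V
  /-- the inverse arc -/
  inv : D → D
  inv_inv : ∀ e, inv (inv e) = e
  inv_ne : ∀ e, inv e ≠ e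
  o_inv : ∀ e, o (inv e) = t e
  t_inv : ∀ e, t (inv e) = o e

namespace ArcGraph

/-- The graph has a vertex, and any two vertices are joined by a path. -/
def Connected {V D : Type*} (G : ArcGraph V D) : Prop :=
  Nonempty V ∧ ∀ u v : V, Relation.ReflTransGen (fun x y => ∃ e, G.o e = x ∧ G.t e = y) u v

/-- The degree of a vertex: the number of arcs emanating from it (a loop counts twice). -/
def degree {V D : Type*} [DecidableEq V] [Fintype D] (G : ArcGraph V D) (v : V) : ℕ :=
  (Finset.univ.filter (fun e => G.o e = v)).card

/-! ### Cycles -/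

/-- A cycle `(e₁, …, eₚ)`, `p ≥ 1`: consecutive arcs fit together, and the last arc ends where the
first one starts. Backtracking is allowed. -/
def IsCycle {V D : Type*} (G : ArcGraph V D) (l : List D) : Prop :=
  l.IsChain (fun e f => G.t e = G.o f) ∧ ∃ h : l ≠ [], G.t (l.getLast h) = G.o (l.head h)

/-- A cycle is prime if it is not a power `B ^ r` of a strictly smaller cycle `B`. -/
def IsPrimeCycle {V D : Type*} (G : ArcGraph V D) (l : List D) : Prop :=
  G.IsCycle l ∧
    ¬ ∃ (B : List D) (r : ℕ), G.IsCycle B ∧ B.length < l.length ∧ l = (List.replicate r B).flatten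

/-- Two cycles `(e₁, …, eₚ)`, `(f₁, …, fₚ)` are equivalent if for some `k`, `f_j = e_{j+k}` for all
`j` (indices modulo `p`), i.e. if one is a rotation of the other. -/
def primeCycleSetoid {V D : Type*} (G : ArcGraph V D) : Setoid {l : List D // G.IsPrimeCycle l} where
  r C C' := C.1.IsRotated C'.1
  iseqv := ⟨fun C => List.IsRotated.refl C.1, fun h => h.symm, fun h h' => h.trans h'⟩

/-- The equivalence classes `[C]` of prime cycles of the graph. -/
def PrimeCycleClass {V D : Type*} (G : ArcGraph V D) : Type _ := Quotient G.primeCycleSetoid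

/-! ### Scattering data, for the wave number `k` -/

/-- `x_v = 2ik / (ik d_v - λ_v)`. -/
noncomputable def x {V D : Type*} [DecidableEq V] [Fintype D] (G : ArcGraph V D)
    (lam : V → ℂ) (k : ℂ) (v : V) : ℂ :=
  2 * Complex.I * k / (Complex.I * k * (G.degree v : ℂ) - lam v)

/-- The vertex scattering coefficient `σ_{ef} = x_{o(e)} - δ_{e⁻¹ f}` (used for `t(f) = o(e)`). -/
noncomputable def sigma {V D : Type*} [DecidableEq V] [Fintype D] [DecidableEq D]
    (G : ArcGraph V D) (lam : V → ℂ) (k : ℂ) (e f : D) : ℂ :=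
  G.x lam k (G.o e) - if G.inv e = f then 1 else 0

/-- `t_e = exp (i L_e (k - A_e))`. -/
noncomputable def phase {D : Type*} (L A : D → ℝ) (k : ℂ) (e : D) : ℂ :=
  Complex.exp (Complex.I * (L e : ℂ) * (k - (A e : ℂ)))

/-- The matrix `U_h`: its `(e, f)` entry is `t_e σ_{ef}` if `t(f) = o(e)` and `α(f) = h`, and `0`
otherwise. -/
noncomputable def U {V D Γ : Type*} [DecidableEq V] [Fintype D] [DecidableEq D] [DecidableEq Γ]
    (G : ArcGraph V D) (L A : D → ℝ) (lam : V → ℂ) (k : ℂ) (α : D → Γ) (h : Γ) :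
    Matrix D D ℂ :=
  Matrix.of fun e f =>
    if G.t f = G.o e ∧ α f = h then phase L A k e * G.sigma lam k e f else 0

/-- The matrix `I - s ∑_h ᵗρ(h) ⊗ U_h`, of size `2md`. -/
noncomputable def lMatrix {V D Γ : Type*} [DecidableEq V] [Fintype D] [DecidableEq D]
    [Group Γ] [Fintype Γ] [DecidableEq Γ] {d : ℕ}
    (G : ArcGraph V D) (L A : D → ℝ) (lam : V → ℂ) (k : ℂ)
    (ρ : Γ →* Matrix.GeneralLinearGroup (Fin d) ℂ) (α : D → Γ) (s : ℂ) :
    Matrix (Fin d × D) (Fin d × D) ℂ :=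
  1 - s • ∑ h : Γ, (ρ h : Matrix (Fin d) (Fin d) ℂ).transpose ⊗ₖ G.U L A lam k α h

/-- The `L`-function `ζ_G(A, L, λ, ρ, α, s) = det (I - s ∑_h ᵗρ(h) ⊗ U_h)⁻¹`. -/
noncomputable def lFunction {V D Γ : Type*} [DecidableEq V] [Fintype D] [DecidableEq D]
    [Group Γ] [Fintype Γ] [DecidableEq Γ] {d : ℕ}
    (G : ArcGraph V D) (L A : D → ℝ) (lam : V → ℂ) (k : ℂ)
    (ρ : Γ →* Matrix.GeneralLinearGroup (Fin d) ℂ) (α : D → Γ) (s : ℂ) : ℂ :=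
  (G.lMatrix L A lam k ρ α s).det⁻¹

/-! ### The local factors of the Euler product -/

/-- `α(C) = α(e₁) ⋯ α(eₚ)`. -/
def voltage {D Γ : Type*} [Group Γ] (α : D → Γ) (l : List D) : Γ :=
  (l.map α).prod

/-- `t_C = t_{e₁} ⋯ t_{eₚ}`. -/
noncomputable def tC {D : Type*} (L A : D → ℝ) (k : ℂ) (l : List D) : ℂ :=
  (l.map (phase L A k)).prod

/-- `a_C`, the product of `σ_{e₂ e₁}, σ_{e₃ e₂}, …, σ_{eₚ eₚ₋₁}, σ_{e₁ eₚ}`. -/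
noncomputable def aC {V D : Type*} [DecidableEq V] [Fintype D] [DecidableEq D]
    (G : ArcGraph V D) (lam : V → ℂ) (k : ℂ) (l : List D) : ℂ :=
  (List.zipWith (G.sigma lam k) (l.rotate 1) l).prod

/-- `det (I_d - ᵗρ(α(C)) t_C a_C s^{|C|})` for a cycle `C`. -/
noncomputable def cycleDet {V D Γ : Type*} [DecidableEq V] [Fintype D] [DecidableEq D]
    [Group Γ] {d : ℕ} (G : ArcGraph V D) (L A : D → ℝ) (lam : V → ℂ) (k : ℂ)
    (ρ : Γ →* Matrix.GeneralLinearGroup (Fin d) ℂ) (α : D → Γ) (s : ℂ) (l : List D) : ℂ :=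
  ((1 : Matrix (Fin d) (Fin d) ℂ) - (tC L A k l * G.aC lam k l * s ^ l.length) •
    (ρ (voltage α l) : Matrix (Fin d) (Fin d) ℂ).transpose).det

theorem aC_rotate {V D : Type*} [DecidableEq V] [Fintype D] [DecidableEq D]
    (G : ArcGraph V D) (lam : V → ℂ) (k : ℂ) (l : List D) (n : ℕ) :
    G.aC lam k (l.rotate n) = G.aC lam k l := by
  have h : List.zipWith (G.sigma lam k) ((l.rotate n).rotate 1) (l.rotate n)
      = (List.zipWith (G.sigma lam k) (l.rotate 1) l).rotate n := by
    rw [List.zipWith_rotate_distrib _ _ _ _ (by simp), List.rotate_rotate, List.rotate_rotate,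
      Nat.add_comm]
  rw [aC, aC, h]
  exact (List.rotate_perm _ n).prod_eq

theorem cycleDet_rotate_one {V D Γ : Type*} [DecidableEq V] [Fintype D] [DecidableEq D]
    [Group Γ] {d : ℕ} (G : ArcGraph V D) (L A : D → ℝ) (lam : V → ℂ) (k : ℂ)
    (ρ : Γ →* Matrix.GeneralLinearGroup (Fin d) ℂ) (α : D → Γ) (s : ℂ) (l : List D) :
    G.cycleDet L A lam k ρ α s (l.rotate 1) = G.cycleDet L A lam k ρ α s l := by
  have hT : tC L A k (l.rotate 1) = tC L A k l :=
    ((List.rotate_perm l 1).map _).prod_eq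
  rw [cycleDet, cycleDet, aC_rotate, hT, List.length_rotate]
  cases l with
  | nil => rfl
  | cons e l =>
    have h1 : voltage α ((e :: l).rotate 1) = voltage α l * α e := by
      simp [voltage]
    have h2 : voltage α (e :: l) = α e * voltage α l := by
      simp [voltage]
    rw [h1, h2, map_mul, map_mul, Units.val_mul, Units.val_mul, Matrix.transpose_mul,
      Matrix.transpose_mul, ← Matrix.smul_mul, Matrix.det_one_sub_mul_comm, Matrix.mul_smul]

theorem cycleDet_isRotated {V D Γ : Type*} [DecidableEq V] [Fintype D] [DecidableEq D]
    [Group Γ] {d : ℕ} (G : ArcGraph V D) (L A : D → ℝ) (lam : V → ℂ) (k : ℂ)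
    (ρ : Γ →* Matrix.GeneralLinearGroup (Fin d) ℂ) (α : D → Γ) (s : ℂ) (l l' : List D)
    (h : l.IsRotated l') :
    G.cycleDet L A lam k ρ α s l = G.cycleDet L A lam k ρ α s l' := by
  obtain ⟨n, rfl⟩ := h
  induction n with
  | zero => simp
  | succ n ih => rw [← List.rotate_rotate, cycleDet_rotate_one, ← ih]

/-- `det (I_d - ᵗρ(α(C)) t_C a_C s^{|C|})` as a function of the class `[C]`. -/
noncomputable def classDet {V D Γ : Type*} [DecidableEq V] [Fintype D] [DecidableEq D]
    [Group Γ] {d : ℕ} (G : ArcGraph V D) (L A : D → ℝ) (lam : V → ℂ) (k : ℂ)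
    (ρ : Γ →* Matrix.GeneralLinearGroup (Fin d) ℂ) (α : D → Γ) (s : ℂ)
    (c : G.PrimeCycleClass) : ℂ :=
  Quotient.lift (s := G.primeCycleSetoid) (fun C : {l : List D // G.IsPrimeCycle l} => G.cycleDet L A lam k ρ α s C.1)
    (fun C C' h => G.cycleDet_isRotated L A lam k ρ α s C.1 C'.1 h) c

end ArcGraph

/-!
The identity is obtained by exponentiating a rearrangement of an absolutely convergent series.

Let `M = ∑_h ᵗρ(h) ⊗ U_h`. For a matrix `X` of norm less than `1`, with eigenvalues `μ`, the
number `logDetInv X = -∑ log (1 - μ)` satisfies `exp (logDetInv X) = det (1 - X)⁻¹` and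
`logDetInv X = ∑ tr (X ^ n) / n` (`Matrix.exp_logDetInv`, `Matrix.hasSum_trace_pow_div`). Write
`s M = ∑_a B_a`, where `B_a` (`ArcGraph.columnBlock`) retains only the columns belonging to the
arc `a`. Expanding the powers gives `logDetInv (s M) = ∑_w tr (B_w) / |w|` over all nonempty words
`w` in the arcs, absolutely convergent as soon as `∑ ‖B_a‖ < 1` (`hasSum_trace_wordProd_div`).

Words that are not cycles have trace zero. A cycle is a power `P ^ j` of a unique prime cycle `P`
(`ArcGraph.bijective_primeCycle_power`), and `B_{P ^ j} = B_P ^ j`, so summing over `j` gives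
`logDetInv (s M) = ∑_P logDetInv (B_P) / |P|`. The class of `P` has exactly `|P|` members
(`ArcGraph.bijective_rotate_primeCycleClass`), all with the same characteristic polynomial, so the
sum over a class is `logDetInv (B_P)` (`ArcGraph.hasSum_classLogDetInv`). The exponential turns this
sum into the product over classes of `det (1 - B_P)⁻¹`.

Finally `B_a` is a block column times a block row, so that `det (1 - X Y) = det (1 - Y X)` reduces
`det (1 - B_P)` to the `d × d` determinant `cycleDet` of `P`
(`ArcGraph.det_one_sub_wordProd_columnBlock`). Powers of words are handled through the minimal
period of a word under rotation by one letter: a cycle is prime exactly when this period is its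
length.
-/

/-! ### The logarithm of a reciprocal determinant -/

section LogDet

open Polynomial

namespace Matrix

variable {ι : Type*} [Fintype ι] [DecidableEq ι]

/-- Both sides are multiplicative in `p`, so it suffices to compare them on constants and on
linear factors. -/
theorem det_aeval_eq_prod_roots_charpoly (X : Matrix ι ι ℂ) (p : ℂ[X]) :
    (aeval X p).det = (X.charpoly.roots.map fun μ => p.eval μ).prod := by
  have hcard : X.charpoly.roots.card = Fintype.card ι := by
    rw [← (IsAlgClosed.splits X.charpoly).natDegree_eq_card_roots, charpoly_natDegree_eq_dim]
  let f : ℂ[X] →* ℂ := detMonoidHom.comp (aeval X : ℂ[X] →ₐ[ℂ] Matrix ι ι ℂ).toMonoidHom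
  let g : ℂ[X] →* ℂ :=
    { toFun := fun p => (X.charpoly.roots.map fun μ => p.eval μ).prod
      map_one' := by simp
      map_mul' := fun p q => by simp [Multiset.prod_map_mul] }
  have hC : ∀ c : ℂ, f (C c) = g (C c) := fun c => by
    simp [f, g, hcard, algebraMap_eq_diagonal]
  have hX : ∀ a : ℂ, f (Polynomial.X - C a) = g (Polynomial.X - C a) := fun a => by
    have h1 : f (Polynomial.X - C a) = (-1) ^ Fintype.card ι * X.charpoly.eval a := by
      rw [eval_charpoly, ← det_neg]
      simp [f, algebraMap_eq_diagonal, Pi.algebraMap_def]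
    have h2 : X.charpoly.eval a = (X.charpoly.roots.map fun μ => a - μ).prod := by
      conv_lhs => rw [(IsAlgClosed.splits X.charpoly).eq_prod_roots_of_monic X.charpoly_monic]
      simp [eval_multiset_prod]
    rw [h1, h2, ← hcard, ← Multiset.card_map (fun μ => a - μ), ← Multiset.prod_map_neg]
    simp [g]
  have hp := (IsAlgClosed.splits p).eq_prod_roots
  change f p = g p
  rw [hp, map_mul, map_mul, hC, map_multiset_prod, map_multiset_prod, Multiset.map_map,
    Multiset.map_map]
  congr 2
  exact Multiset.map_congr rfl fun a _ => hX a

theorem trace_pow_eq_sum_roots_charpoly (X : Matrix ι ι ℂ) (n : ℕ) :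
    (X ^ n).trace = (X.charpoly.roots.map fun μ => μ ^ n).sum := by
  have h : (X ^ n).charpoly =
      ((X.charpoly.roots.map fun μ => μ ^ n).map fun a => Polynomial.X - C a).prod := by
    refine Polynomial.funext fun z => ?_
    have := det_aeval_eq_prod_roots_charpoly X (C z - Polynomial.X ^ n)
    rw [eval_charpoly, eval_multiset_prod, Multiset.map_map, Multiset.map_map]
    simpa [algebraMap_eq_diagonal, Pi.algebraMap_def, scalar_apply] using this
  rw [trace_eq_sum_roots_charpoly, h, roots_multiset_prod_X_sub_C]

/-- The logarithm of `det (1 - X)⁻¹`, by the principal branch at each eigenvalue. It depends on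
the characteristic polynomial of `X` only. -/
noncomputable def logDetInv (X : Matrix ι ι ℂ) : ℂ :=
  (X.charpoly.roots.map fun μ => -Complex.log (1 - μ)).sum

attribute [local instance] Matrix.linftyOpNormedRing Matrix.linftyOpNormedAlgebra

theorem norm_lt_one_of_mem_roots_charpoly {X : Matrix ι ι ℂ} (hX : ‖X‖ < 1) {μ : ℂ}
    (hμ : μ ∈ X.charpoly.roots) : ‖μ‖ < 1 := by
  cases isEmpty_or_nonempty ι
  · simp [charpoly, det_isEmpty] at hμ
  · have h : μ ∈ spectrum ℂ X :=
      mem_spectrum_iff_isRoot_charpoly.2 (isRoot_of_mem_roots hμ)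
    exact (spectrum.norm_le_norm_of_mem h).trans_lt hX

theorem hasSum_trace_pow_div {X : Matrix ι ι ℂ} (hX : ‖X‖ < 1) :
    HasSum (fun n : ℕ => (X ^ n).trace / n) X.logDetInv := by
  have key : ∀ S : Multiset ℂ, (∀ μ ∈ S, ‖μ‖ < 1) →
      HasSum (fun n : ℕ => (S.map fun μ => μ ^ n).sum / n)
        (S.map fun μ => -Complex.log (1 - μ)).sum := by
    intro S
    induction S using Multiset.induction with
    | empty => simp
    | cons a S ih =>
      intro h
      have h1 := Complex.hasSum_taylorSeries_neg_log (h a (Multiset.mem_cons_self a S))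
      have h2 := ih fun μ hμ => h μ (Multiset.mem_cons_of_mem hμ)
      simpa [add_div] using h1.add h2
  simp only [trace_pow_eq_sum_roots_charpoly]
  exact key _ fun μ hμ => norm_lt_one_of_mem_roots_charpoly hX hμ

theorem exp_logDetInv {X : Matrix ι ι ℂ} (hX : ‖X‖ < 1) :
    Complex.exp X.logDetInv = (1 - X).det⁻¹ := by
  have h := det_aeval_eq_prod_roots_charpoly X (1 - Polynomial.X)
  simp only [map_sub, map_one, aeval_X, eval_sub, eval_one, eval_X] at h
  rw [h, logDetInv, Complex.exp_multiset_sum, Multiset.map_map, ← Multiset.prod_map_inv]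
  congr 1
  refine Multiset.map_congr rfl fun μ hμ => ?_
  have h1 : 1 - μ ≠ 0 := fun h0 => by
    have := norm_lt_one_of_mem_roots_charpoly hX hμ
    rw [← sub_eq_zero.1 h0] at this
    simp at this
  simp [Complex.exp_neg, Complex.exp_log h1]

theorem det_one_sub_ne_zero {X : Matrix ι ι ℂ} (hX : ‖X‖ < 1) : (1 - X).det ≠ 0 := fun h => by
  simpa [h] using exp_logDetInv hX

theorem norm_trace_le (X : Matrix ι ι ℂ) : ‖X.trace‖ ≤ Fintype.card ι * ‖X‖ := by
  refine (norm_sum_le _ _).trans ?_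
  have h : ∀ i ∈ Finset.univ, ‖X.diag i‖ ≤ ‖X‖ := fun i _ => by
    have := linfty_opNorm_mulVec X (Pi.single i 1)
    rw [mulVec_single_one, Pi.norm_single, norm_one, mul_one] at this
    exact (norm_le_pi_norm (X.col i) i).trans this
  simpa using Finset.sum_le_sum h

end Matrix

end LogDet

/-! ### Summation over words -/

section Words

/-- The product `B (eₚ) ⋯ B (e₁)` along the word `(e₁, …, eₚ)`, the last letter standing
leftmost. -/
def wordProd {D R : Type*} [Monoid R] (B : D → R) (l : List D) : R :=
  (l.map B).reverse.prod

@[simp]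
theorem wordProd_nil {D R : Type*} [Monoid R] (B : D → R) : wordProd B [] = 1 := rfl

@[simp]
theorem wordProd_cons {D R : Type*} [Monoid R] (B : D → R) (a : D) (l : List D) :
    wordProd B (a :: l) = wordProd B l * B a := by
  simp [wordProd]

theorem wordProd_append {D R : Type*} [Monoid R] (B : D → R) (l l' : List D) :
    wordProd B (l ++ l') = wordProd B l' * wordProd B l := by
  simp [wordProd]

theorem wordProd_flatten_replicate {D R : Type*} [Monoid R] (B : D → R) (l : List D) (n : ℕ) :
    wordProd B (List.replicate n l).flatten = wordProd B l ^ n := by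
  induction n with
  | zero => simp
  | succ n ih => rw [List.replicate_succ, List.flatten_cons, wordProd_append, ih, pow_succ]

theorem sum_pow_eq_sum_wordProd {D R : Type*} [Fintype D] [Semiring R] (B : D → R) (n : ℕ) :
    (∑ a, B a) ^ n = ∑ w : Fin n → D, wordProd B (List.ofFn w) := by
  induction n with
  | zero => simp
  | succ n ih =>
    rw [pow_succ, ih, ← (Fin.consEquiv fun _ => D).sum_comp, Fintype.sum_prod_type_right,
      Finset.sum_mul_sum]
    simp [Fin.consEquiv, List.ofFn_succ]

theorem norm_wordProd_le {D R : Type*} [NormedRing R] (B : D → R) {l : List D} (hl : l ≠ []) :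
    ‖wordProd B l‖ ≤ wordProd (fun a => ‖B a‖) l := by
  refine (List.norm_prod_le' (by simpa using hl)).trans_eq ?_
  rw [wordProd, List.map_reverse, List.map_map]
  rfl

variable {D ι : Type*} [Fintype D] [Fintype ι] [DecidableEq ι]

attribute [local instance] Matrix.linftyOpNormedRing Matrix.linftyOpNormedAlgebra

theorem summable_wordProd_of_nonneg {x : D → ℝ} (hx : ∀ a, 0 ≤ x a) (h : ∑ a, x a < 1) :
    Summable (wordProd x) := by
  have h0 : ∀ l, 0 ≤ wordProd x l := fun l => by
    induction l with
    | nil => simp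
    | cons a l ih => simpa using mul_nonneg ih (hx a)
  rw [← List.equivSigmaTuple.symm.summable_iff,
    summable_sigma_of_nonneg (f := wordProd x ∘ List.equivSigmaTuple.symm) fun _ => h0 _]
  refine ⟨fun n => .of_finite, ?_⟩
  simp only [tsum_fintype]
  have := summable_geometric_of_lt_one (Finset.sum_nonneg fun a _ => hx a) h
  simp only [sum_pow_eq_sum_wordProd] at this
  exact this

theorem norm_sum_lt_one_of_sum_norm_lt_one {B : D → Matrix ι ι ℂ} (hB : ∑ a, ‖B a‖ < 1) :
    ‖∑ a, B a‖ < 1 :=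
  (norm_sum_le _ _).trans_lt hB

theorem norm_wordProd_lt_one {R : Type*} [NormedRing R] {B : D → R} (hB : ∑ a, ‖B a‖ < 1)
    {l : List D} (hl : l ≠ []) : ‖wordProd B l‖ < 1 := by
  have h1 : ∀ a, ‖B a‖ < 1 := fun a =>
    (Finset.single_le_sum (f := fun a => ‖B a‖) (fun _ _ => norm_nonneg _)
      (Finset.mem_univ a)).trans_lt hB
  cases l with
  | nil => exact absurd rfl hl
  | cons a l =>
    have h2 : 0 ≤ wordProd (fun a => ‖B a‖) l ∧ wordProd (fun a => ‖B a‖) l ≤ 1 := by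
      induction l with
      | nil => simp
      | cons b l ih =>
        obtain ⟨h0, h1'⟩ := ih (by simp)
        rw [wordProd_cons]
        exact ⟨mul_nonneg h0 (norm_nonneg _), mul_le_one₀ h1' (norm_nonneg _) (h1 b).le⟩
    refine (norm_wordProd_le B hl).trans_lt ?_
    rw [wordProd_cons]
    exact (mul_le_of_le_one_left (norm_nonneg _) h2.2).trans_lt (h1 a)

/-- The expansion of `∑ tr ((∑ B a) ^ n) / n` into words. The empty word contributes `0`, since
division by its length is division by zero. -/
theorem hasSum_trace_wordProd_div {B : D → Matrix ι ι ℂ} (hB : ∑ a, ‖B a‖ < 1) :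
    HasSum (fun l : List D => (wordProd B l).trace / l.length) (∑ a, B a).logDetInv := by
  have hs : Summable fun l : List D => (wordProd B l).trace / l.length := by
    refine .of_norm_bounded
      ((summable_wordProd_of_nonneg (fun a => norm_nonneg (B a)) hB).mul_left
        (Fintype.card ι : ℝ)) fun l => ?_
    rcases eq_or_ne l [] with rfl | hl
    · simp
    · have h1 : (1 : ℝ) ≤ ‖(l.length : ℂ)‖ := by
        simpa [Nat.one_le_iff_ne_zero] using hl
      rw [norm_div]
      refine (div_le_self (norm_nonneg _) h1).trans ((Matrix.norm_trace_le _).trans ?_)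
      gcongr
      exact norm_wordProd_le B hl
  rw [← List.equivSigmaTuple.symm.hasSum_iff]
  have hs' := (List.equivSigmaTuple.symm.summable_iff.2 hs).hasSum
  have h1 := hs'.sigma fun n => hasSum_fintype _
  have h2 := Matrix.hasSum_trace_pow_div (norm_sum_lt_one_of_sum_norm_lt_one hB)
  convert hs' using 1
  refine h2.unique ?_
  convert h1 using 2 with n
  simp [sum_pow_eq_sum_wordProd, Matrix.trace_sum, Finset.sum_div, List.equivSigmaTuple]

end Words

/-! ### Rotations and powers of words -/

section Rotation

variable {D : Type*}

/-- The least positive `n` such that rotating the word `l` by `n` places gives back `l`. -/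
noncomputable def rotationPeriod (l : List D) : ℕ :=
  Function.minimalPeriod (fun l : List D => l.rotate 1) l

theorem iterate_rotate_one (l : List D) (n : ℕ) :
    (fun l : List D => l.rotate 1)^[n] l = l.rotate n := by
  induction n with
  | zero => simp
  | succ n ih => rw [Function.iterate_succ_apply', ih, List.rotate_rotate]

theorem rotationPeriod_dvd_iff {l : List D} {n : ℕ} :
    rotationPeriod l ∣ n ↔ l.rotate n = l := by
  rw [rotationPeriod, ← Function.isPeriodicPt_iff_minimalPeriod_dvd, Function.IsPeriodicPt,
    Function.IsFixedPt, iterate_rotate_one]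

theorem rotationPeriod_dvd_length (l : List D) : rotationPeriod l ∣ l.length :=
  rotationPeriod_dvd_iff.2 l.rotate_length

theorem rotationPeriod_pos {l : List D} (hl : l ≠ []) : 0 < rotationPeriod l :=
  Nat.pos_of_dvd_of_pos (rotationPeriod_dvd_length l) (List.length_pos_iff.2 hl)

theorem rotationPeriod_rotate (l : List D) (n : ℕ) :
    rotationPeriod (l.rotate n) = rotationPeriod l := by
  refine Nat.dvd_right_iff_eq.1 fun k => ?_
  rw [rotationPeriod_dvd_iff, rotationPeriod_dvd_iff, List.rotate_rotate, Nat.add_comm,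
    ← List.rotate_rotate, List.rotate_eq_rotate]

theorem length_flatten_replicate (n : ℕ) (l : List D) :
    (List.replicate n l).flatten.length = n * l.length := by
  simp

theorem rotate_flatten_replicate (n k : ℕ) (l : List D) :
    (List.replicate n l).flatten.rotate k = (List.replicate n (l.rotate k)).flatten := by
  have h1 : ∀ l : List D,
      (List.replicate n l).flatten.rotate 1 = (List.replicate n (l.rotate 1)).flatten := by
    intro l
    rcases l with _ | ⟨a, t⟩
    · simp
    rcases n with _ | n
    · simp
    have h : ∀ n : ℕ, t ++ (List.replicate n (a :: t)).flatten ++ [a] =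
        (List.replicate (n + 1) (t ++ [a])).flatten := by
      intro n
      induction n with
      | zero => simp
      | succ n ih =>
        rw [List.replicate_succ (n := n + 1), List.flatten_cons, ← ih]
        simp [List.replicate_succ]
    rw [show (a :: t).rotate 1 = t ++ [a] by simp, ← h]
    simp [List.replicate_succ]
  induction k generalizing l with
  | zero => simp
  | succ k ih => rw [← List.rotate_rotate, ih, h1, List.rotate_rotate]

theorem flatten_replicate_inj {n : ℕ} (hn : n ≠ 0) {l l' : List D} (hlen : l.length = l'.length) :
    (List.replicate n l).flatten = (List.replicate n l').flatten ↔ l = l' := by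
  refine ⟨fun h => ?_, fun h => h ▸ rfl⟩
  obtain ⟨n, rfl⟩ := Nat.exists_eq_succ_of_ne_zero hn
  rw [List.replicate_succ, List.replicate_succ, List.flatten_cons, List.flatten_cons] at h
  exact (List.append_inj h hlen).1

theorem rotationPeriod_flatten_replicate {n : ℕ} (hn : n ≠ 0) (l : List D) :
    rotationPeriod (List.replicate n l).flatten = rotationPeriod l := by
  refine Nat.dvd_right_iff_eq.1 fun k => ?_
  rw [rotationPeriod_dvd_iff, rotationPeriod_dvd_iff, rotate_flatten_replicate,
    flatten_replicate_inj hn (List.length_rotate l k)]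

/-- Commuting words whose lengths are in integral proportion are powers of the shorter one. -/
theorem eq_flatten_replicate_of_append_comm {u v : List D} {k : ℕ} (h : u ++ v = v ++ u)
    (hlen : v.length = k * u.length) : v = (List.replicate k u).flatten := by
  induction k generalizing v with
  | zero => simpa using hlen
  | succ k ih =>
    have hp : u <+: v := by
      refine List.prefix_of_prefix_length_le (List.prefix_append u v) (h ▸ List.prefix_append v u) ?_
      rw [hlen]
      exact Nat.le_mul_of_pos_left _ k.succ_pos
    obtain ⟨w, rfl⟩ := hp
    rw [List.append_assoc] at h
    have h' := List.append_cancel_left h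
    rw [List.replicate_succ, List.flatten_cons, ← ih h']
    simp only [List.length_append] at hlen
    linarith

theorem eq_flatten_replicate_take {l : List D} {p : ℕ} (hp : p ∣ l.length) (h : l.rotate p = l) :
    l = (List.replicate (l.length / p) (l.take p)).flatten := by
  rcases eq_or_ne l [] with rfl | hl
  · simp
  have hle := Nat.le_of_dvd (List.length_pos_iff.2 hl) hp
  have hlen : (l.take p).length = p := by simpa using hle
  rw [List.rotate_eq_drop_append_take hle] at h
  obtain ⟨k, hk⟩ := hp
  have hp0 : 0 < p := Nat.pos_of_ne_zero fun h0 => hl (by simpa [h0] using hk)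
  rcases k with _ | k
  · exact absurd (by simpa using hk) hl
  have hd := eq_flatten_replicate_of_append_comm (u := l.take p) (v := l.drop p) (k := k)
    (by rw [h, List.take_append_drop]) (by rw [hlen, List.length_drop, hk, mul_add, mul_comm]; simp)
  rw [hk, Nat.mul_div_cancel_left _ hp0, List.replicate_succ, List.flatten_cons, ← hd,
    List.take_append_drop]

end Rotation

/-! ### Prime cycles and their powers -/

namespace ArcGraph

variable {V D : Type*} {G : ArcGraph V D}

theorem isCycle_cons_iff {a : D} {l : List D} :
    G.IsCycle (a :: l) ↔ (a :: (l ++ [a])).IsChain fun e f => G.t e = G.o f := by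
  rw [← List.cons_append, List.isChain_append]
  simp [IsCycle, List.getLast?_eq_some_getLast]

theorem IsCycle.ne_nil {l : List D} (h : G.IsCycle l) : l ≠ [] := h.2.1

theorem IsCycle.rotate {l : List D} (h : G.IsCycle l) (n : ℕ) : G.IsCycle (l.rotate n) := by
  have h1 : ∀ l : List D, G.IsCycle l → G.IsCycle (l.rotate 1) := by
    intro l h
    match l with
    | [] => exact absurd rfl h.ne_nil
    | [a] => simpa using h
    | a :: b :: l =>
      simp only [List.rotate_cons_succ, List.rotate_zero, List.cons_append]
      rw [isCycle_cons_iff] at h ⊢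
      simp only [List.cons_append, List.isChain_cons_cons] at h
      rw [List.append_assoc, List.singleton_append, List.isChain_cons_append_cons_cons]
      exact ⟨h.2, h.1, by simp⟩
  induction n with
  | zero => simpa
  | succ n ih => rw [← List.rotate_rotate]; exact h1 _ ih

/-- For a closed walk `B` the junction of two successive copies of `B` is the closing condition
of `B`. -/
theorem isCycle_flatten_replicate_iff {n : ℕ} (hn : n ≠ 0) {B : List D} :
    G.IsCycle (List.replicate n B).flatten ↔ G.IsCycle B := by
  obtain ⟨n, rfl⟩ := Nat.exists_eq_succ_of_ne_zero hn
  rcases B with _ | ⟨a, t⟩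
  · simp
  induction n with
  | zero => simp
  | succ n ih =>
    have key : G.IsCycle (List.replicate (n + 2) (a :: t)).flatten ↔
        G.IsCycle (a :: t) ∧ G.IsCycle (List.replicate (n + 1) (a :: t)).flatten := by
      rw [List.replicate_succ, List.flatten_cons, List.replicate_succ, List.flatten_cons,
        List.cons_append, List.cons_append, isCycle_cons_iff, isCycle_cons_iff, isCycle_cons_iff,
        List.append_assoc, List.cons_append, List.isChain_cons_split]
    rw [key, ih n.succ_ne_zero, and_self]

theorem isPrimeCycle_iff {l : List D} :
    G.IsPrimeCycle l ↔ G.IsCycle l ∧ rotationPeriod l = l.length := by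
  refine and_congr_right fun hl => ⟨fun h => ?_, ?_⟩
  · by_contra hne
    have hdvd := rotationPeriod_dvd_length l
    have hpos := List.length_pos_iff.2 hl.ne_nil
    have hlt := lt_of_le_of_ne (Nat.le_of_dvd hpos hdvd) hne
    have heq := eq_flatten_replicate_take hdvd (rotationPeriod_dvd_iff.1 dvd_rfl)
    have hn : l.length / rotationPeriod l ≠ 0 :=
      (Nat.div_pos hlt.le (rotationPeriod_pos hl.ne_nil)).ne'
    refine h ⟨_, _, (isCycle_flatten_replicate_iff hn).1 (heq ▸ hl), ?_, heq⟩
    simpa using hlt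
  · rintro h ⟨B, r, hB, hlt, rfl⟩
    rcases eq_or_ne r 0 with rfl | hr
    · exact hl.ne_nil (by simp)
    rw [rotationPeriod_flatten_replicate hr] at h
    have := Nat.le_of_dvd (List.length_pos_iff.2 hB.ne_nil) (rotationPeriod_dvd_length B)
    omega

theorem IsPrimeCycle.rotate {l : List D} (h : G.IsPrimeCycle l) (n : ℕ) :
    G.IsPrimeCycle (l.rotate n) := by
  rw [isPrimeCycle_iff] at h ⊢
  exact ⟨h.1.rotate n, by rw [rotationPeriod_rotate, h.2, List.length_rotate]⟩

/-- Every cycle is a positive power of exactly one prime cycle: the initial segment whose length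
is the rotation period. -/
theorem bijective_primeCycle_power :
    Function.Bijective fun x : {l : List D // G.IsPrimeCycle l} × ℕ =>
      (⟨(List.replicate (x.2 + 1) x.1.1).flatten,
        (isCycle_flatten_replicate_iff x.2.succ_ne_zero).2 x.1.2.1⟩ : {l : List D // G.IsCycle l}) := by
  constructor
  · rintro ⟨⟨P, hP⟩, m⟩ ⟨⟨Q, hQ⟩, n⟩ h
    have h' : (List.replicate (m + 1) P).flatten = (List.replicate (n + 1) Q).flatten :=
      congrArg Subtype.val h
    have hlen : P.length = Q.length := by
      rw [← (isPrimeCycle_iff.1 hP).2, ← (isPrimeCycle_iff.1 hQ).2,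
        ← rotationPeriod_flatten_replicate m.succ_ne_zero, h',
        rotationPeriod_flatten_replicate n.succ_ne_zero]
    have hmn : m = n := by
      have h2 := congrArg List.length h'
      rw [length_flatten_replicate, length_flatten_replicate, hlen] at h2
      exact Nat.succ_injective
        (Nat.eq_of_mul_eq_mul_right (List.length_pos_iff.2 hQ.1.ne_nil) h2)
    subst hmn
    obtain rfl := (flatten_replicate_inj m.succ_ne_zero hlen).1 h'
    rfl
  · rintro ⟨l, hl⟩
    have hpos := rotationPeriod_pos hl.ne_nil
    have hle := Nat.le_of_dvd (List.length_pos_iff.2 hl.ne_nil) (rotationPeriod_dvd_length l)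
    have heq := eq_flatten_replicate_take (rotationPeriod_dvd_length l)
      (rotationPeriod_dvd_iff.1 dvd_rfl)
    obtain ⟨n, hn⟩ := Nat.exists_eq_succ_of_ne_zero (Nat.div_pos hle hpos).ne'
    rw [hn] at heq
    refine ⟨⟨⟨l.take (rotationPeriod l), isPrimeCycle_iff.2 ⟨?_, ?_⟩⟩, n⟩, Subtype.ext heq.symm⟩
    · exact (isCycle_flatten_replicate_iff n.succ_ne_zero).1 (heq ▸ hl)
    · rw [← rotationPeriod_flatten_replicate n.succ_ne_zero, ← heq]
      simpa using hle

/-- A class of prime cycles of length `p` has exactly `p` members. -/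
theorem bijective_rotate_primeCycleClass (P : {l : List D // G.IsPrimeCycle l}) :
    Function.Bijective fun i : Fin P.1.length =>
      (⟨⟨P.1.rotate i, P.2.rotate i⟩,
        Quotient.sound (s := G.primeCycleSetoid) (List.IsRotated.forall P.1 i)⟩ :
        {Q : {l : List D // G.IsPrimeCycle l} //
          (Quotient.mk G.primeCycleSetoid Q : G.PrimeCycleClass) =
            Quotient.mk G.primeCycleSetoid P}) := by
  constructor
  · intro i j h
    have h' : P.1.rotate i = P.1.rotate j := congrArg (fun Q => Q.1.1) h
    have hper := (isPrimeCycle_iff.1 P.2).2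
    rw [← iterate_rotate_one, ← iterate_rotate_one] at h'
    exact Fin.ext (Function.iterate_injOn_Iio_minimalPeriod
      (i.2.trans_eq hper.symm) (j.2.trans_eq hper.symm) h')
  · rintro ⟨Q, hQ⟩
    obtain ⟨n, hn⟩ : P.1.IsRotated Q.1 := (Quotient.exact (s := G.primeCycleSetoid) hQ).symm
    refine ⟨⟨n % P.1.length, Nat.mod_lt _ (List.length_pos_iff.2 P.2.1.ne_nil)⟩, ?_⟩
    refine Subtype.ext (Subtype.ext ?_)
    simpa only [List.rotate_mod] using hn

end ArcGraph

/-! ### Regrouping the words into classes of prime cycles -/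

section Regroup

attribute [local instance] Matrix.linftyOpNormedRing Matrix.linftyOpNormedAlgebra

theorem charpoly_wordProd_rotate {D ι : Type*} [Fintype ι] [DecidableEq ι]
    (B : D → Matrix ι ι ℂ) (l : List D) (n : ℕ) :
    (wordProd B (l.rotate n)).charpoly = (wordProd B l).charpoly := by
  induction n with
  | zero => simp
  | succ n ih =>
    rw [← List.rotate_rotate, ← ih]
    rcases l.rotate n with _ | ⟨a, t⟩
    · simp
    · rw [List.rotate_cons_succ, List.rotate_zero, wordProd_append, wordProd_cons,
        Matrix.charpoly_mul_comm, wordProd_cons, wordProd_nil, one_mul]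

namespace ArcGraph

variable {V D ι : Type*} [Fintype D] [Fintype ι] [DecidableEq ι] {G : ArcGraph V D}

/-- `log det (1 - B_C)⁻¹` as a function of the class `[C]`, where `B_C` is the product of the
matrices `B a` along `C`. -/
noncomputable def classLogDetInv (G : ArcGraph V D) (B : D → Matrix ι ι ℂ)
    (c : G.PrimeCycleClass) : ℂ :=
  Quotient.lift (s := G.primeCycleSetoid)
    (fun C : {l : List D // G.IsPrimeCycle l} => (wordProd B C.1).logDetInv)
    (fun C C' h => by
      obtain ⟨n, hn⟩ : C.1.IsRotated C'.1 := h
      simp only [Matrix.logDetInv, ← hn, charpoly_wordProd_rotate]) c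

theorem hasSum_logDetInv_primeCycle {B : D → Matrix ι ι ℂ} (hB : ∑ a, ‖B a‖ < 1)
    (h0 : ∀ l, l ≠ [] → ¬ G.IsCycle l → (wordProd B l).trace = 0) :
    HasSum (fun P : {l : List D // G.IsPrimeCycle l} => (wordProd B P.1).logDetInv / P.1.length)
      (∑ a, B a).logDetInv := by
  have hw := hasSum_trace_wordProd_div hB
  have hc : HasSum (fun l : {l : List D // G.IsCycle l} => (wordProd B l.1).trace / l.1.length)
      (∑ a, B a).logDetInv := by
    refine (hasSum_subtype_iff_of_support_subset (s := {l | G.IsCycle l}) ?_).2 hw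
    intro l hl
    by_contra hn
    rcases eq_or_ne l [] with rfl | hne
    · simp at hl
    · simp [h0 l hne hn] at hl
  rw [← (Equiv.ofBijective _ bijective_primeCycle_power).hasSum_iff] at hc
  refine hc.prod_fiberwise fun P => ?_
  have hP := Matrix.hasSum_trace_pow_div (norm_wordProd_lt_one hB P.2.1.ne_nil)
  -- the term at exponent `0` is a division by zero, hence zero
  rw [← hasSum_nat_add_iff' 1] at hP
  simp only [Finset.range_one, Finset.sum_singleton, Nat.cast_zero, div_zero, sub_zero] at hP
  simpa [wordProd_flatten_replicate, div_div] using hP.div_const (P.1.length : ℂ)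

theorem hasSum_classLogDetInv {B : D → Matrix ι ι ℂ} (hB : ∑ a, ‖B a‖ < 1)
    (h0 : ∀ l, l ≠ [] → ¬ G.IsCycle l → (wordProd B l).trace = 0) :
    HasSum (G.classLogDetInv B) (∑ a, B a).logDetInv := by
  have h := hasSum_logDetInv_primeCycle hB h0
  rw [← (Equiv.sigmaFiberEquiv
    (Quotient.mk G.primeCycleSetoid : _ → G.PrimeCycleClass)).hasSum_iff] at h
  refine h.sigma fun c => ?_
  induction c using Quotient.inductionOn with | h P => ?_
  -- the class of `P` contributes `|P|` equal terms, each divided by `|P|`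
  rw [← (Equiv.ofBijective _ (bijective_rotate_primeCycleClass P)).hasSum_iff]
  have hP : (P.1.length : ℂ) ≠ 0 := by simpa using P.2.1.ne_nil
  convert hasSum_fintype fun _ : Fin P.1.length =>
    (wordProd B P.1).logDetInv / P.1.length using 1
  · funext i
    simp [Matrix.logDetInv, charpoly_wordProd_rotate]
  · simp [classLogDetInv]
    field_simp

end ArcGraph

end Regroup

/-! ### The column blocks of the edge matrix -/

namespace ArcGraph

variable {D : Type*} {d : ℕ}

/-- The left factor of a column block: the block column whose block at the arc `e` is the `d × d`
matrix `b(e, a) Y`. -/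
noncomputable def blockColumn (b : D → D → ℂ) (a : D) (Y : Matrix (Fin d) (Fin d) ℂ) :
    Matrix (Fin d × D) (Fin d) ℂ :=
  Matrix.of fun p j => b p.2 a * Y p.1 j

theorem blockColumn_mul (b : D → D → ℂ) (a : D) (Y Z : Matrix (Fin d) (Fin d) ℂ) :
    blockColumn b a Y * Z = blockColumn b a (Y * Z) := by
  ext p j
  simp [Matrix.mul_apply, blockColumn, Finset.mul_sum, mul_assoc]

theorem prod_zipWith_append_singleton (b : D → D → ℂ) (a y : D) (l : List D) :
    b y ((a :: l).getLast (List.cons_ne_nil a l)) * (List.zipWith b l (a :: l)).prod =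
      (List.zipWith b (l ++ [y]) (a :: l)).prod := by
  induction l generalizing a with
  | nil => simp
  | cons c l ih =>
    rw [List.cons_append, List.zipWith_cons_cons, List.zipWith_cons_cons, List.prod_cons,
      List.prod_cons, ← ih, List.getLast_cons_cons]
    ring

theorem wordProd_smul_transpose {Γ : Type*} [Group Γ] (ρ : Γ →* Matrix.GeneralLinearGroup (Fin d) ℂ)
    (α : D → Γ) (s : ℂ) (l : List D) :
    wordProd (fun a => s • (ρ (α a) : Matrix (Fin d) (Fin d) ℂ).transpose) l =
      s ^ l.length • (ρ (voltage α l) : Matrix (Fin d) (Fin d) ℂ).transpose := by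
  induction l with
  | nil => simp [voltage]
  | cons a l ih =>
    have h : voltage α (a :: l) = α a * voltage α l := by simp [voltage]
    rw [wordProd_cons, ih, h, map_mul, Units.val_mul, Matrix.transpose_mul, Matrix.smul_mul,
      Matrix.mul_smul, smul_smul, List.length_cons, pow_succ]

variable {V Γ : Type*} [DecidableEq V] [Fintype D] [DecidableEq D]

/-- The weight `t_e σ_{ef}` of the transition from `f` to `e`, zero if `f` does not end where `e`
starts. -/
noncomputable def transition (G : ArcGraph V D) (L A : D → ℝ) (lam : V → ℂ) (k : ℂ) (e f : D) : ℂ :=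
  if G.t f = G.o e then phase L A k e * G.sigma lam k e f else 0

/-- The product of the transition weights from each arc of `a :: l` to the next one, with `y`
following the last arc; it vanishes unless these arcs form a walk. -/
theorem prod_zipWith_transition (G : ArcGraph V D) (L A : D → ℝ) (lam : V → ℂ) (k : ℂ)
    (a y : D) (l : List D) :
    (List.zipWith (G.transition L A lam k) (l ++ [y]) (a :: l)).prod =
      open Classical in
      if (a :: (l ++ [y])).IsChain (fun e f => G.t e = G.o f) then
        tC L A k (l ++ [y]) * (List.zipWith (G.sigma lam k) (l ++ [y]) (a :: l)).prod
      else 0 := by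
  induction l generalizing a with
  | nil => simp [transition, tC]
  | cons b l ih =>
    simp only [List.cons_append, List.zipWith_cons_cons, List.prod_cons, ih,
      List.isChain_cons_cons, transition, tC, List.map_cons]
    by_cases h1 : G.t a = G.o b
    · split_ifs <;> simp_all
      ring
    · simp [h1]

theorem prod_zipWith_transition_rotate {G : ArcGraph V D} (L A : D → ℝ) (lam : V → ℂ) (k : ℂ)
    {l : List D} (hl : l ≠ []) :
    (List.zipWith (G.transition L A lam k) (l.rotate 1) l).prod =
      open Classical in if G.IsCycle l then tC L A k l * G.aC lam k l else 0 := by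
  rcases l with _ | ⟨a, t⟩
  · exact absurd rfl hl
  have hT : tC L A k (t ++ [a]) = tC L A k (a :: t) := by simp [tC, mul_comm]
  rw [aC, List.rotate_cons_succ, List.rotate_zero, prod_zipWith_transition, hT]
  simp only [isCycle_cons_iff]

/-- The right factor of a column block: it selects the rows belonging to the arc `a`. -/
def blockRow (d : ℕ) (a : D) : Matrix (Fin d) (Fin d × D) ℂ :=
  Matrix.of fun i q => if i = q.1 ∧ a = q.2 then 1 else 0

theorem blockRow_mul_blockColumn (b : D → D → ℂ) (a c : D) (Y : Matrix (Fin d) (Fin d) ℂ) :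
    blockRow d a * blockColumn b c Y = b a c • Y := by
  ext i j
  simp [Matrix.mul_apply, blockRow, blockColumn, Fintype.sum_prod_type, ite_and]

/-- Each junction of two consecutive letters contracts to a scalar transition weight, leaving the
block column of the last letter and the block row of the first one. -/
theorem wordProd_blockColumn_mul_blockRow (b : D → D → ℂ) (R : D → Matrix (Fin d) (Fin d) ℂ)
    (a : D) (l : List D) :
    wordProd (fun c => blockColumn b c (R c) * blockRow d c) (a :: l) =
      blockColumn b ((a :: l).getLast (List.cons_ne_nil a l))
        ((List.zipWith b l (a :: l)).prod • wordProd R (a :: l)) * blockRow d a := by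
  induction l generalizing a with
  | nil => simp
  | cons c l ih =>
    rw [wordProd_cons, ih, ← Matrix.mul_assoc, Matrix.mul_assoc _ (blockRow d c),
      blockRow_mul_blockColumn, blockColumn_mul]
    congr 2
    rw [wordProd_cons R a, List.zipWith_cons_cons, List.prod_cons, Matrix.smul_mul,
      Matrix.mul_smul, smul_smul, mul_comm]

theorem blockRow_mul_blockColumn_getLast (b : D → D → ℂ) (a : D) (l : List D)
    (Y : Matrix (Fin d) (Fin d) ℂ) :
    blockRow d a * blockColumn b ((a :: l).getLast (List.cons_ne_nil a l))
        ((List.zipWith b l (a :: l)).prod • Y) =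
      (List.zipWith b ((a :: l).rotate 1) (a :: l)).prod • Y := by
  rw [blockRow_mul_blockColumn, smul_smul, prod_zipWith_append_singleton, List.rotate_cons_succ,
    List.rotate_zero]

theorem trace_wordProd_blockColumn_mul_blockRow (b : D → D → ℂ)
    (R : D → Matrix (Fin d) (Fin d) ℂ) {l : List D} (hl : l ≠ []) :
    (wordProd (fun c => blockColumn b c (R c) * blockRow d c) l).trace =
      (List.zipWith b (l.rotate 1) l).prod * (wordProd R l).trace := by
  rcases l with _ | ⟨a, t⟩
  · exact absurd rfl hl
  rw [wordProd_blockColumn_mul_blockRow, Matrix.trace_mul_comm, blockRow_mul_blockColumn_getLast,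
    Matrix.trace_smul, smul_eq_mul]

theorem det_one_sub_wordProd_blockColumn_mul_blockRow (b : D → D → ℂ)
    (R : D → Matrix (Fin d) (Fin d) ℂ) {l : List D} (hl : l ≠ []) :
    (1 - wordProd (fun c => blockColumn b c (R c) * blockRow d c) l).det =
      (1 - (List.zipWith b (l.rotate 1) l).prod • wordProd R l).det := by
  rcases l with _ | ⟨a, t⟩
  · exact absurd rfl hl
  rw [wordProd_blockColumn_mul_blockRow, Matrix.det_one_sub_mul_comm,
    blockRow_mul_blockColumn_getLast]

variable [Group Γ]

/-- The part of `s ∑_h ᵗρ(h) ⊗ U_h` supported on the columns that belong to the arc `a`. -/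
noncomputable def columnBlock (G : ArcGraph V D) (L A : D → ℝ) (lam : V → ℂ) (k : ℂ)
    (ρ : Γ →* Matrix.GeneralLinearGroup (Fin d) ℂ) (α : D → Γ) (s : ℂ) (a : D) :
    Matrix (Fin d × D) (Fin d × D) ℂ :=
  blockColumn (G.transition L A lam k) a (s • (ρ (α a) : Matrix (Fin d) (Fin d) ℂ).transpose) *
    blockRow d a

theorem columnBlock_eq_smul (G : ArcGraph V D) (L A : D → ℝ) (lam : V → ℂ) (k : ℂ)
    (ρ : Γ →* Matrix.GeneralLinearGroup (Fin d) ℂ) (α : D → Γ) (s : ℂ) (a : D) :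
    G.columnBlock L A lam k ρ α s a = s • G.columnBlock L A lam k ρ α 1 a := by
  rw [columnBlock, columnBlock, ← Matrix.smul_mul]
  congr 1
  ext p j
  simp [blockColumn, mul_left_comm]

theorem one_sub_sum_columnBlock [Fintype Γ] [DecidableEq Γ] (G : ArcGraph V D) (L A : D → ℝ)
    (lam : V → ℂ) (k : ℂ) (ρ : Γ →* Matrix.GeneralLinearGroup (Fin d) ℂ) (α : D → Γ) (s : ℂ) :
    1 - ∑ a, G.columnBlock L A lam k ρ α s a = G.lMatrix L A lam k ρ α s := by
  rw [lMatrix]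
  congr 1
  ext ⟨i, e⟩ ⟨j, f⟩
  have h1 : ∀ a, G.columnBlock L A lam k ρ α s a (i, e) (j, f) =
      if a = f then s * (G.transition L A lam k e f *
        (ρ (α f) : Matrix (Fin d) (Fin d) ℂ) j i) else 0 := by
    intro a
    by_cases h : a = f
    · subst h
      simp [columnBlock, blockColumn, blockRow, Matrix.mul_apply, mul_left_comm]
    · simp [columnBlock, blockColumn, blockRow, Matrix.mul_apply, h]
  simp only [Matrix.sum_apply, h1, Matrix.smul_apply, Matrix.kroneckerMap_apply, U, Matrix.of_apply,
    Finset.sum_ite_eq', Finset.mem_univ, if_true, transition, smul_eq_mul, Matrix.transpose_apply]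
  congr 1
  by_cases h : G.t f = G.o e
  · simp [h, mul_comm]
  · simp [h]

theorem trace_wordProd_columnBlock_eq_zero (G : ArcGraph V D) (L A : D → ℝ)
    (lam : V → ℂ) (k : ℂ) (ρ : Γ →* Matrix.GeneralLinearGroup (Fin d) ℂ) (α : D → Γ) (s : ℂ)
    {l : List D} (hl : l ≠ []) (hc : ¬ G.IsCycle l) :
    (wordProd (G.columnBlock L A lam k ρ α s) l).trace = 0 := by
  unfold columnBlock
  rw [trace_wordProd_blockColumn_mul_blockRow _ _ hl, prod_zipWith_transition_rotate _ _ _ _ hl,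
    if_neg hc, zero_mul]

theorem det_one_sub_wordProd_columnBlock (G : ArcGraph V D) (L A : D → ℝ)
    (lam : V → ℂ) (k : ℂ) (ρ : Γ →* Matrix.GeneralLinearGroup (Fin d) ℂ) (α : D → Γ) (s : ℂ)
    {l : List D} (hc : G.IsCycle l) :
    (1 - wordProd (G.columnBlock L A lam k ρ α s) l).det = G.cycleDet L A lam k ρ α s l := by
  unfold columnBlock
  rw [det_one_sub_wordProd_blockColumn_mul_blockRow _ _ hc.ne_nil,
    prod_zipWith_transition_rotate _ _ _ _ hc.ne_nil, if_pos hc, wordProd_smul_transpose, smul_smul,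
    cycleDet]

end ArcGraph

/-! ### The Euler product -/

attribute [local instance] Matrix.linftyOpNormedRing Matrix.linftyOpNormedAlgebra

theorem theorem7 {V D Γ : Type*} [Fintype V] [DecidableEq V] [Fintype D] [DecidableEq D]
    [Group Γ] [Fintype Γ] [DecidableEq Γ]
    (G : ArcGraph V D) (hG : G.Connected)
    (L : D → ℝ) (hL_pos : ∀ e, 0 < L e) (hL_inv : ∀ e, L (G.inv e) = L e)
    (A : D → ℝ) (hA_inv : ∀ e, A (G.inv e) = -A e)
    (lam : V → ℂ) (k : ℂ)
    (hk : ∀ v, Complex.I * k * (G.degree v : ℂ) - lam v ≠ 0)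
    (α : D → Γ) (hα : ∀ e, α (G.inv e) = (α e)⁻¹)
    {d : ℕ} (ρ : Γ →* Matrix.GeneralLinearGroup (Fin d) ℂ) :
    ∃ r : ℝ, 0 < r ∧ ∀ s : ℂ, ‖s‖ < r →
      (G.lMatrix L A lam k ρ α s).det ≠ 0 ∧
      (∀ c : G.PrimeCycleClass, G.classDet L A lam k ρ α s c ≠ 0) ∧
      HasProd (fun c : G.PrimeCycleClass => (G.classDet L A lam k ρ α s c)⁻¹)
        (G.lFunction L A lam k ρ α s) := by
  set K : ℝ := ∑ a, ‖G.columnBlock L A lam k ρ α 1 a‖ with hK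
  have hK0 : 0 ≤ K := Finset.sum_nonneg fun _ _ => norm_nonneg _
  refine ⟨(K + 1)⁻¹, by positivity, fun s hs => ?_⟩
  have hB : ∑ a, ‖G.columnBlock L A lam k ρ α s a‖ < 1 := by
    have h1 : ∀ a, ‖G.columnBlock L A lam k ρ α s a‖ =
        ‖s‖ * ‖G.columnBlock L A lam k ρ α 1 a‖ := fun a => by
      rw [G.columnBlock_eq_smul, norm_smul]
    rw [Finset.sum_congr rfl fun a _ => h1 a, ← Finset.mul_sum, ← hK]
    have h2 : ‖s‖ * (K + 1) < 1 := by
      rwa [← lt_div_iff₀ (by positivity), one_div]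
    nlinarith [norm_nonneg s]
  have hnorm := norm_sum_lt_one_of_sum_norm_lt_one hB
  have hdet : ∀ P : {l : List D // G.IsPrimeCycle l},
      (1 - wordProd (G.columnBlock L A lam k ρ α s) P.1).det =
        G.classDet L A lam k ρ α s (Quotient.mk G.primeCycleSetoid P) :=
    fun P => G.det_one_sub_wordProd_columnBlock L A lam k ρ α s P.2.1
  refine ⟨?_, fun c => ?_, ?_⟩
  · rw [← G.one_sub_sum_columnBlock]
    exact Matrix.det_one_sub_ne_zero hnorm
  · induction c using Quotient.inductionOn with | h P => ?_
    rw [← hdet P]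
    exact Matrix.det_one_sub_ne_zero (norm_wordProd_lt_one hB P.2.1.ne_nil)
  · have h := (ArcGraph.hasSum_classLogDetInv hB fun l hl hc =>
      G.trace_wordProd_columnBlock_eq_zero L A lam k ρ α s hl hc).cexp
    rw [Matrix.exp_logDetInv hnorm, G.one_sub_sum_columnBlock] at h
    have hexp : (fun c => (G.classDet L A lam k ρ α s c)⁻¹) =
        Complex.exp ∘ G.classLogDetInv (G.columnBlock L A lam k ρ α s) := funext fun c => by
      induction c using Quotient.inductionOn with | h P => ?_
      rw [← hdet P]
      exact (Matrix.exp_logDetInv (norm_wordProd_lt_one hB P.2.1.ne_nil)).symm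
    rw [hexp]
    exact h
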